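/- Let $1\le k\le n$ and, for $X\in M_n(\mathbb C)$, let $g(X)=\|X\|_{(k)}=s_1(X)+\cdots+s_k(X)$ be its Ky Fan $k$-norm, where $s_1(X)\ge\cdots\ge s_n(X)\ge 0$ are the singular values of $X$. The subdifferential $\partial g(A)$ is the set of linear functionals $\varphi$ on $M_n(\mathbb C)$ with $g(Y)-g(A)\ge \operatorname{Re}\varphi(Y-A)$ for all $Y\in M_n(\mathbb C)$; it is regarded as a set of matrices by identifying $G\in M_n(\mathbb C)$ with the functional $X\mapsto\operatorname{tr}(G^*X)$. Let $A\in M_n(\mathbb C)$ be a positive semidefinite matrix with eigenvalues $\lambda_1(A)\ge\cdots\ge\lambda_n(A)\ge 0$ (counted with multiplicity) such that $\lambda_k(A)>0$. Then $$\partial g(A)=\operatorname{conv}\Big\{\sum_{i=1}^k u_iu_i^* : u_1,\dots,u_k\in\mathbb C^n \text{ orthonormal},\ Au_i=\lambda_i(A)u_i \text{ for all } 1\le i\le k\Big\}.$$ -/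

import Mathlib

open Matrix
open scoped ComplexOrder

noncomputable section

/-- The subdifferential at `a` of a real-valued function `f` on a complex topological vector space:
the set of continuous linear functionals `φ` with `f y - f a ≥ Re φ (y - a)` for all `y`. -/
def subdifferential {X : Type*} [AddCommGroup X] [Module ℂ X] [TopologicalSpace X]
    (f : X → ℝ) (a : X) : Set (X →L[ℂ] ℂ) :=
  {φ | ∀ y : X, f y - f a ≥ (φ (y - a)).re}

/-- The functional `X ↦ tr (G* X)` on complex `n × n` matrices given by a matrix `G`. -/
def traceFunctional {n : ℕ} (G : Matrix (Fin n) (Fin n) ℂ) :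
    Matrix (Fin n) (Fin n) ℂ →L[ℂ] ℂ where
  toFun X := (Gᴴ * X).trace
  map_add' X Y := by rw [Matrix.mul_add, Matrix.trace_add]
  map_smul' c X := by simp [Matrix.trace_smul]
  cont := by fun_prop

/-- The identification of matrices with functionals loses nothing. -/
theorem traceFunctional_bijective (n : ℕ) :
    Function.Bijective (traceFunctional (n := n)) := by
  have key : ∀ (G : Matrix (Fin n) (Fin n) ℂ) (i j : Fin n),
      traceFunctional G (Matrix.single i j 1) = star (G i j) := by
    intro G i j
    change (Gᴴ * Matrix.single i j 1).trace = _
    simp [Matrix.trace_mul_single]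
  constructor
  · intro G H h
    ext i j
    have := key G i j
    rw [h, key H i j] at this
    exact (star_injective this).symm
  · intro φ
    refine ⟨Matrix.of fun i j => star (φ (Matrix.single i j 1)), ?_⟩
    ext X
    rw [Matrix.matrix_eq_sum_single X]
    simp only [map_sum]
    refine Finset.sum_congr rfl fun i _ => Finset.sum_congr rfl fun j _ => ?_
    have hs : Matrix.single i j (X i j) = X i j • Matrix.single i j (1 : ℂ) := by
      simp [Matrix.smul_single]
    rw [hs, map_smul, map_smul, key]
    simp

/-- The subdifferential of a function of matrices as a set of matrices, where `G` stands for the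
functional `X ↦ tr (G* X)`. -/
def matrixSubdifferential {n : ℕ} (f : Matrix (Fin n) (Fin n) ℂ → ℝ)
    (A : Matrix (Fin n) (Fin n) ℂ) : Set (Matrix (Fin n) (Fin n) ℂ) :=
  {G | traceFunctional G ∈ subdifferential f A}

/-- The Ky Fan `k`-norm: the sum of the `k` largest singular values (Mathlib lists the singular
values of a linear map in decreasing order, starting from index `0`). -/
def kyFanNorm {n : ℕ} (k : ℕ) (A : Matrix (Fin n) (Fin n) ℂ) : ℝ :=
  ∑ i ∈ Finset.range k, (Matrix.toEuclideanLin A).singularValues i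

/-- The eigenvalues of a Hermitian matrix in decreasing order, with multiplicity; the index `i`
counts from `0`. (Mathlib's `IsHermitian.eigenvalues` is not ordered, `eigenvalues₀` is.) -/
def orderedEigenvalue {n : ℕ} {A : Matrix (Fin n) (Fin n) ℂ} (hA : A.IsHermitian)
    (i : Fin n) : ℝ :=
  hA.eigenvalues₀ (Fin.cast (Fintype.card_fin n).symm i)

end

/-! Testing the subgradient inequality at `0` and `2A` shows that a subgradient `G` is norming: Re
tr(G*A) = g(A), and Re tr(G*Y) ≤ g(Y) for all `Y`. Conversely, Ky Fan's inequality makes each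
projection on the right norming, and the subdifferential is convex.

For the hard inclusion, let d_j be the real diagonal entries of `G` in an eigenbasis of `A`. Testing
on rank one projections and on diagonal sign matrices gives d_j ≤ 1 and ∑|d_j| ≤ k, while ∑ λ_j d_j
equals the sum of the first k eigenvalues. Since λ_k > 0, the equality case
(`eq_of_sum_mul_eq_sum_castLE`) gives d_j = 1 above λ_k, d_j = 0 below it, and trace k. Trace k and
the dual norm bound force `G` to be positive (`isPositive_of_norming`). From 0 ≤ G ≤ 1 it follows
that `G` fixes the eigenvectors above λ_k and kills those below.

So `G` is a fixed projection plus a part on the λ_k-eigenspace with spectrum in [0, 1] and integral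
trace. Its spectrum is a point of a hypersimplex, hence a convex combination of 0/1 vectors
(`Convex.add_sum_smul_mem_of_hypersimplex`), and these give the required projections. -/

/-! ### Weighted sums of antitone sequences -/

theorem Fin.sum_castLE_eq_sum_ite {M : Type*} [AddCommMonoid M] {n k : ℕ} (hkn : k ≤ n)
    (f : Fin n → M) :
    ∑ i : Fin k, f (Fin.castLE hkn i) = ∑ j : Fin n, if (j : ℕ) < k then f j else 0 := by
  rw [← Finset.sum_filter]
  refine Finset.sum_bij (fun i _ => Fin.castLE hkn i) (by simp) (by simp) ?_ (by simp)
  intro j hj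
  exact ⟨⟨j, by simpa using hj⟩, by simp, by ext; simp⟩

/-- A weighted sum of a nonnegative antitone sequence, with weights in `[0, 1]` of total mass at
most `k`, is at most the sum of its first `k` terms. -/
theorem sum_mul_le_sum_castLE_of_antitone {n k : ℕ} (hk : 1 ≤ k) (hkn : k ≤ n) {s c : Fin n → ℝ}
    (hs : Antitone s) (hs0 : ∀ j, 0 ≤ s j) (hc0 : ∀ j, 0 ≤ c j) (hc1 : ∀ j, c j ≤ 1)
    (hc : ∑ j, c j ≤ k) :
    ∑ j, s j * c j ≤ ∑ i : Fin k, s (Fin.castLE hkn i) := by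
  have hone := Fin.sum_castLE_eq_sum_ite hkn (fun _ => (1 : ℝ))
  simp only [Finset.sum_const, Finset.card_univ, Fintype.card_fin, nsmul_eq_mul, mul_one] at hone
  rw [Fin.sum_castLE_eq_sum_ite hkn s]
  obtain ⟨m, hm⟩ : ∃ m : Fin n, (m : ℕ) + 1 = k := by
    obtain ⟨j, rfl⟩ := Nat.exists_eq_add_of_le' hk
    exact ⟨⟨j, hkn⟩, rfl⟩
  set t := s m with ht
  -- The pivot `t` is the `k`-th value: `s j - t` and `c j - 1_{j<k}` never have the same strict
  -- sign.
  have key : ∀ j : Fin n, s j * c j - (if (j : ℕ) < k then s j else 0) ≤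
      t * (c j - if (j : ℕ) < k then 1 else 0) := by
    intro j
    split_ifs with h
    · have : t ≤ s j := hs (Fin.le_def.2 (by omega) : j ≤ m)
      nlinarith [hc1 j]
    · have : s j ≤ t := hs (Fin.le_def.2 (by omega) : m ≤ j)
      nlinarith [hc0 j]
  have := Finset.sum_le_sum fun j (_ : j ∈ Finset.univ) => key j
  rw [Finset.sum_sub_distrib, ← Finset.mul_sum, Finset.sum_sub_distrib, ← hone] at this
  nlinarith [hs0 m]

/-- The case of equality in `sum_mul_le_sum_castLE_of_antitone`. -/
theorem eq_of_sum_mul_eq_sum_castLE {n k : ℕ} (hkn : k ≤ n) {s d : Fin n → ℝ}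
    {m : Fin n} (hm : (m : ℕ) + 1 = k)
    (hs : Antitone s) (hs0 : ∀ j, 0 ≤ s j) (hpos : 0 < s m)
    (hd1 : ∀ j, d j ≤ 1) (hd : ∑ j, |d j| ≤ k)
    (heq : ∑ j, s j * d j = ∑ i : Fin k, s (Fin.castLE hkn i)) :
    (∀ j, s m < s j → d j = 1) ∧
    (∀ j, s j < s m → d j = 0) ∧ ∑ j, d j = k := by
  have hone := Fin.sum_castLE_eq_sum_ite hkn (fun _ => (1 : ℝ))
  simp only [Finset.sum_const, Finset.card_univ, Fintype.card_fin, nsmul_eq_mul, mul_one] at hone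
  rw [Fin.sum_castLE_eq_sum_ite hkn s] at heq
  set t := s m with ht
  have hlt : ∀ j : Fin n, (j : ℕ) < k → t ≤ s j := fun j h =>
    hs (Fin.le_def.2 (by omega) : j ≤ m)
  have hge : ∀ j : Fin n, ¬ (j : ℕ) < k → s j ≤ t := fun j h =>
    hs (Fin.le_def.2 (by omega) : m ≤ j)
  -- Summed, the left side is `0` and the right side is `t * (∑ |d j| - k) ≤ 0`. As `t > 0`, the
  -- mass is exactly `k` and equality holds term by term.
  have key : ∀ j ∈ Finset.univ, s j * d j - (if (j : ℕ) < k then s j else 0) ≤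
      t * (|d j| - if (j : ℕ) < k then 1 else 0) := by
    intro j _
    have h0 := le_abs_self (d j)
    split_ifs with h
    · nlinarith [hd1 j, hlt j h]
    · nlinarith [hge j h, hs0 j, abs_nonneg (d j)]
  have hle := Finset.sum_le_sum key
  have hL : ∑ j, (s j * d j - (if (j : ℕ) < k then s j else 0)) = 0 := by
    rw [Finset.sum_sub_distrib, heq, sub_self]
  have hR : ∑ j, t * (|d j| - if (j : ℕ) < k then 1 else 0) = t * (∑ j, |d j| - k) := by
    rw [← Finset.mul_sum, Finset.sum_sub_distrib, ← hone]
  have hsum : ∑ j, |d j| = k := by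
    rw [hL, hR] at hle
    nlinarith
  have hterm := (Finset.sum_eq_sum_iff_of_le key).1 (by rw [hL, hR, hsum]; simp)
  have h0 : ∀ j, |d j| = d j ∧ (t < s j → d j = 1) ∧ (s j < t → d j = 0) := by
    intro j
    have h1 := hterm j (Finset.mem_univ j)
    have h2 := le_abs_self (d j)
    split_ifs at h1 with h
    · have h3 := hlt j h
      have h4 : |d j| = d j := by nlinarith [hd1 j]
      refine ⟨h4, fun h5 => ?_, fun h5 => absurd h3 (not_le.2 h5)⟩
      rw [h4] at h1
      have : (s j - t) * (d j - 1) = 0 := by linarith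
      rcases mul_eq_zero.1 this with h6 | h6 <;> linarith
    · have h3 := hge j h
      have h5 : s j < t → d j = 0 := fun h5 => by
        have : |d j| = 0 := by nlinarith [hs0 j, abs_nonneg (d j)]
        simpa using this
      refine ⟨?_, fun h5 => absurd h3 (not_le.2 h5), h5⟩
      rcases h3.lt_or_eq with h6 | h6
      · simp [h5 h6]
      · rw [h6] at h1
        have : t * (|d j| - d j) = 0 := by linarith
        rcases mul_eq_zero.1 this with h6 | h6 <;> linarith
  refine ⟨fun j => (h0 j).2.1, fun j => (h0 j).2.2, ?_⟩
  rw [← hsum]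
  exact Finset.sum_congr rfl fun j _ => (h0 j).1.symm

/-! ### Hypersimplices and a kernel criterion -/

/-- If a convex set contains all `C + ∑ j ∈ S, p j` with `S ⊆ Z` of cardinality `m`, then it
contains `C + ∑ j, x j • p j` for every `x` in the hypersimplex of parameter `m` on `Z`. -/
theorem Convex.add_sum_smul_mem_of_hypersimplex {ι V : Type*} [Fintype ι]
    [AddCommGroup V] [Module ℝ V] {K : Set V} (hK : Convex ℝ K) (C : V) (p : ι → V) (m : ℕ)
    (Z : Set ι)
    (h : ∀ S : Finset ι, S.card = m → (∀ j ∈ S, j ∈ Z) → C + ∑ j ∈ S, p j ∈ K)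
    (x : ι → ℝ) (hx0 : ∀ j, 0 ≤ x j) (hx1 : ∀ j, x j ≤ 1) (hZ : ∀ j, x j ≠ 0 → j ∈ Z)
    (hx : ∑ j, x j = m) : C + ∑ j, x j • p j ∈ K := by
  classical
  -- Induction on the number of non-integral coordinates.
  induction hN : (Finset.univ.filter fun j => x j ≠ 0 ∧ x j ≠ 1).card using
    Nat.strong_induction_on generalizing x with
  | _ N ih =>
  by_cases hfrac : ∃ i, x i ≠ 0 ∧ x i ≠ 1
  · obtain ⟨i, hi0, hi1⟩ := hfrac
    -- A single fractional coordinate would make the integer `m` lie strictly between two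
    -- consecutive integers.
    obtain ⟨j, hji, hj0, hj1⟩ : ∃ j, j ≠ i ∧ x j ≠ 0 ∧ x j ≠ 1 := by
      by_contra! hcon
      have hint : ∑ j ∈ Finset.univ.erase i, x j =
          ((Finset.univ.erase i).filter fun j => x j = 1).card := by
        rw [Finset.card_filter]
        push_cast
        refine Finset.sum_congr rfl fun j hj => ?_
        by_cases hj0 : x j = 0
        · simp [hj0]
        · simp [hcon j (Finset.ne_of_mem_erase hj) hj0]
      have hsplit := Finset.add_sum_erase Finset.univ x (Finset.mem_univ i)
      rw [hint, hx] at hsplit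
      set q := ((Finset.univ.erase i).filter fun j => x j = 1).card
      have h1 : (q : ℝ) < m := by linarith [(hx0 i).lt_of_ne' hi0]
      have h2 : (m : ℝ) < q + 1 := by linarith [(hx1 i).lt_of_ne hi1]
      have h1' : q < m := by exact_mod_cast h1
      have h2' : m < q + 1 := by exact_mod_cast h2
      omega
    have hi0' := (hx0 i).lt_of_ne' hi0
    have hj0' := (hx0 j).lt_of_ne' hj0
    have hi1' := (hx1 i).lt_of_ne hi1
    have hj1' := (hx1 j).lt_of_ne hj1
    -- shifting mass from one fractional coordinate to another until one of them is integral
    have step : ∀ i j : ι, j ≠ i → x i ≠ 0 → x i ≠ 1 → x j ≠ 0 → x j ≠ 1 →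
        C + (∑ l, x l • p l + min (1 - x i) (x j) • (p i - p j)) ∈ K := by
      intro i j hji hi0 hi1 hj0 hj1
      have hi0' := (hx0 i).lt_of_ne' hi0
      have hj0' := (hx0 j).lt_of_ne' hj0
      have hi1' := (hx1 i).lt_of_ne hi1
      have hj1' := (hx1 j).lt_of_ne hj1
      set a := min (1 - x i) (x j) with ha
      have ha0 : 0 < a := lt_min (by linarith) hj0'
      have ha1 : a ≤ 1 - x i := min_le_left _ _
      have ha2 : a ≤ x j := min_le_right _ _
      set y : ι → ℝ := fun l => x l + a * ((if l = i then 1 else 0) - if l = j then 1 else 0)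
      have hyi : y i = x i + a := by simp [y, hji.symm]
      have hyj : y j = x j - a := by simp [y, hji]; ring
      have hyl : ∀ l, l ≠ i → l ≠ j → y l = x l := fun l h1 h2 => by simp [y, h1, h2]
      have hsum : ∑ l, y l • p l = ∑ l, x l • p l + a • (p i - p j) := by
        simp [y, add_smul, Finset.sum_add_distrib, mul_smul, sub_smul, ← Finset.smul_sum,
          Finset.sum_sub_distrib]
      rw [← hsum]
      refine ih _ ?_ y ?_ ?_ ?_ ?_ rfl
      · rw [← hN]
        apply Finset.card_lt_card
        rw [Finset.ssubset_iff_of_subset]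
        · rcases min_choice (1 - x i) (x j) with hm | hm
          · exact ⟨i, by simp [hi0, hi1], by simp [hyi, ha, hm]⟩
          · exact ⟨j, by simp [hj0, hj1], by simp [hyj, ha, hm]⟩
        · intro l
          by_cases h1 : l = i
          · subst h1; simp [hi0, hi1]
          by_cases h2 : l = j
          · subst h2; simp [hj0, hj1]
          simp [hyl l h1 h2]
      · intro l
        by_cases h1 : l = i
        · rw [h1, hyi]; linarith
        by_cases h2 : l = j
        · rw [h2, hyj]; linarith
        rw [hyl l h1 h2]; exact hx0 l
      · intro l
        by_cases h1 : l = i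
        · rw [h1, hyi]; linarith
        by_cases h2 : l = j
        · rw [h2, hyj]; linarith
        rw [hyl l h1 h2]; exact hx1 l
      · intro l hl
        by_cases h1 : l = i
        · rw [h1]; exact hZ i hi0
        by_cases h2 : l = j
        · rw [h2]; exact hZ j hj0
        rw [hyl l h1 h2] at hl; exact hZ l hl
      · simp [y, Finset.sum_add_distrib, ← Finset.mul_sum, hx]
    have h1 := step i j hji hi0 hi1 hj0 hj1
    have h2 := step j i hji.symm hj0 hj1 hi0 hi1
    set a := min (1 - x i) (x j)
    set b := min (1 - x j) (x i)
    have ha : 0 < a := lt_min (by linarith) hj0'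
    have hb : 0 < b := lt_min (by linarith) hi0'
    have hab : a + b ≠ 0 := by positivity
    -- The two shifts, of sizes `a` and `b`, go in opposite directions, so weights proportional to
    -- `b` and `a` recover `x`.
    have := hK h1 h2 (a := b / (a + b)) (b := a / (a + b)) (by positivity) (by positivity)
      (by field_simp; ring)
    convert this using 1
    match_scalars <;> field_simp <;> ring
  · push Not at hfrac
    have hS : ∑ j, x j • p j = ∑ j ∈ Finset.univ.filter (fun j => x j ≠ 0), p j := by
      rw [Finset.sum_filter]
      refine Finset.sum_congr rfl fun j _ => ?_
      by_cases hj : x j = 0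
      · simp [hj]
      · simp [hfrac j hj]
    rw [hS]
    refine h _ ?_ fun j hj => hZ j (by simpa using hj)
    have : ((Finset.univ.filter fun j => x j ≠ 0).card : ℝ) = m := by
      rw [← hx, Finset.card_filter]
      push_cast
      refine Finset.sum_congr rfl fun j _ => ?_
      by_cases hj : x j = 0
      · simp [hj]
      · simp [hfrac j hj]
    exact_mod_cast this

/-- The form at `x + r T x` has no constant term, so a small negative `r` would make it negative
unless `T x = 0`. -/
theorem LinearMap.IsPositive.apply_eq_zero_of_re_inner_eq_zero
    {E : Type*} [NormedAddCommGroup E] [InnerProductSpace ℂ E] {T : E →ₗ[ℂ] E} (hT : T.IsPositive) {x : E}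
    (hx : (inner ℂ (T x) x).re = 0) : T x = 0 := by
  set c := (inner ℂ (T (T x)) (T x)).re with hc
  have hc0 : 0 ≤ c := hT.re_inner_nonneg_left (T x)
  have key : ∀ r : ℝ, 0 ≤ 2 * r * ‖T x‖ ^ 2 + r ^ 2 * c := by
    intro r
    have h := hT.re_inner_nonneg_left (x + (r : ℂ) • T x)
    have h1 : inner ℂ (T (T x)) x = inner ℂ (T x) (T x) := hT.isSymmetric _ _
    simp only [map_add, map_smul, inner_add_left, inner_add_right, inner_smul_left,
      inner_smul_right, h1, inner_self_eq_norm_sq_to_K, RCLike.re_to_complex, Complex.add_re, hx,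
      Complex.conj_ofReal, Complex.re_ofReal_mul, ← hc] at h
    norm_num [← Complex.ofReal_pow] at h
    linarith
  -- The `+ 1` covers `c = 0`.
  have h := key (-(‖T x‖ ^ 2 / (c + 1)))
  have h2 : 2 * -(‖T x‖ ^ 2 / (c + 1)) * ‖T x‖ ^ 2 + (-(‖T x‖ ^ 2 / (c + 1))) ^ 2 * c =
      -(‖T x‖ ^ 4 * (c + 2)) / (c + 1) ^ 2 := by
    field_simp
    ring
  rw [h2, le_div_iff₀ (by positivity)] at h
  by_contra hne
  have : 0 < ‖T x‖ ^ 4 * (c + 2) := by positivity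
  linarith

/-! ### Ky Fan's inequality and singular values -/

section Operators

variable {E : Type*} [NormedAddCommGroup E] [InnerProductSpace ℂ E]

/-- Ky Fan's inequality for a linear map given by a singular value type decomposition
`T (b j) = s j • w j` with antitone weights `s` and a Bessel family `w` of vectors. -/
theorem LinearMap.sum_re_inner_le_sum_castLE {n k : ℕ} (hk : 1 ≤ k) (hkn : k ≤ n) (T : E →ₗ[ℂ] E)
    (b : OrthonormalBasis (Fin n) ℂ E) (w : Fin n → E) {s : Fin n → ℝ} (hs : Antitone s)
    (hs0 : ∀ j, 0 ≤ s j) (hT : ∀ j, T (b j) = (s j : ℂ) • w j) (hw1 : ∀ j, ‖w j‖ ≤ 1)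
    (hw2 : ∀ x, ∑ j, ‖inner ℂ (w j) x‖ ^ 2 ≤ ‖x‖ ^ 2) {u : Fin k → E} (hu : Orthonormal ℂ u) :
    ∑ i, (inner ℂ (u i) (T (u i))).re ≤ ∑ i : Fin k, s (Fin.castLE hkn i) := by
  -- These weights come from the bound `2xy ≤ x² + y²`. Bessel for `u` gives `c j ≤ 1`; Parseval for
  -- `b` and Bessel for `w` give total mass at most `k`.
  set c : Fin n → ℝ := fun j =>
    ∑ i, (‖inner ℂ (b j) (u i)‖ ^ 2 + ‖inner ℂ (w j) (u i)‖ ^ 2) / 2 with hc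
  have hbessel : ∀ x, ∑ i, ‖inner ℂ x (u i)‖ ^ 2 ≤ ‖x‖ ^ 2 := fun x => by
    simpa only [norm_inner_symm x] using hu.sum_inner_products_le x (s := Finset.univ)
  refine le_trans ?_ (sum_mul_le_sum_castLE_of_antitone hk hkn (c := c) hs hs0 ?_ ?_ ?_)
  · simp only [hc, Finset.mul_sum]
    rw [Finset.sum_comm]
    refine Finset.sum_le_sum fun i _ => ?_
    have hx : T (u i) = ∑ j, (inner ℂ (b j) (u i) * (s j : ℂ)) • w j := by
      conv_lhs => rw [← b.sum_repr' (u i)]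
      simp only [map_sum, map_smul, hT, smul_smul]
    rw [hx, inner_sum, Complex.re_sum]
    refine Finset.sum_le_sum fun j _ => ?_
    have h1 : (inner ℂ (u i) ((inner ℂ (b j) (u i) * (s j : ℂ)) • w j)).re =
        s j * (inner ℂ (b j) (u i) * inner ℂ (u i) (w j)).re := by
      rw [inner_smul_right, mul_right_comm, mul_comm, Complex.re_ofReal_mul]
    rw [h1]
    refine mul_le_mul_of_nonneg_left ?_ (hs0 j)
    refine (Complex.re_le_norm _).trans ?_
    rw [norm_mul, norm_inner_symm (u i)]
    nlinarith [sq_nonneg (‖inner ℂ (b j) (u i)‖ - ‖inner ℂ (w j) (u i)‖)]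
  · exact fun j => Finset.sum_nonneg fun i _ => by positivity
  · intro j
    simp only [hc]
    rw [← Finset.sum_div, Finset.sum_add_distrib]
    have h1 := hbessel (b j)
    have h2 := hbessel (w j)
    rw [b.orthonormal.1 j] at h1
    have := hw1 j
    have := norm_nonneg (w j)
    nlinarith
  · simp only [hc]
    rw [Finset.sum_comm]
    calc _ ≤ ∑ i : Fin k, (1 : ℝ) := Finset.sum_le_sum fun i _ => by
          rw [← Finset.sum_div, Finset.sum_add_distrib, b.sum_sq_norm_inner_right]
          have := hw2 (u i)
          rw [hu.1 i] at this ⊢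
          linarith
      _ = k := by simp

variable [FiniteDimensional ℂ E]

/-- Right singular vectors of a linear map. -/
theorem LinearMap.exists_orthonormalBasis_adjoint_apply_apply {n : ℕ}
    (hn : Module.finrank ℂ E = n) (T : E →ₗ[ℂ] E) :
    ∃ b : OrthonormalBasis (Fin n) ℂ E,
      ∀ j : Fin n, T.adjoint (T (b j)) = ((T.singularValues j : ℂ) ^ 2) • b j := by
  refine ⟨T.isSymmetric_adjoint_comp_self.eigenvectorBasis hn, fun j => ?_⟩
  have := T.isSymmetric_adjoint_comp_self.apply_eigenvectorBasis hn j
  rw [← T.sq_singularValues_fin hn j] at this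
  exact this.trans (by norm_num)

/-- Ky Fan's inequality. -/
theorem LinearMap.sum_re_inner_le_sum_singularValues {n k : ℕ} (hn : Module.finrank ℂ E = n)
    (hk : 1 ≤ k) (hkn : k ≤ n) (T : E →ₗ[ℂ] E) {u : Fin k → E} (hu : Orthonormal ℂ u) :
    ∑ i, (inner ℂ (u i) (T (u i))).re ≤ ∑ i ∈ Finset.range k, T.singularValues i := by
  obtain ⟨b, hb⟩ := T.exists_orthonormalBasis_adjoint_apply_apply hn
  set s : Fin n → ℝ := fun j => T.singularValues j with hs
  have hin : ∀ i j, inner ℂ (T (b i)) (T (b j)) = if i = j then (s j : ℂ) ^ 2 else 0 := by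
    intro i j
    rw [← LinearMap.adjoint_inner_right, hb, inner_smul_right, b.inner_eq_ite]
    simp [hs]
  -- Since `0⁻¹ = 0`, `w j` vanishes when `s j = 0`; the family is then only Bessel, which suffices.
  set w : Fin n → E := fun j => ((s j)⁻¹ : ℂ) • T (b j) with hw
  have hwin : ∀ i j, inner ℂ (w i) (w j) = if i = j ∧ s j ≠ 0 then (1 : ℂ) else 0 := by
    intro i j
    simp only [hw, inner_smul_left, inner_smul_right, hin]
    by_cases hij : i = j
    · subst hij
      by_cases h0 : s i = 0
      · simp [h0]
      · have : (s i : ℂ) ≠ 0 := by exact_mod_cast h0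
        simp [h0]
        field_simp
    · simp [hij]
  have hworth : Orthonormal ℂ fun j : {j // s j ≠ 0} => w j := by
    rw [orthonormal_iff_ite]
    intro i j
    rw [hwin]
    simp [j.2, Subtype.ext_iff]
  have hw0 : ∀ j, s j = 0 → w j = 0 := fun j hj => by simp [hw, hj]
  refine (T.sum_re_inner_le_sum_castLE hk hkn b w (s := s) ?_ ?_ ?_ ?_ ?_ hu).trans_eq ?_
  · exact fun i j hij => T.singularValues_antitone hij
  · exact fun j => T.singularValues_nonneg j
  · intro j
    by_cases h0 : s j = 0
    · have := hin j j
      simp only [h0, if_true] at this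
      rw [hw0 j h0, smul_zero]
      simpa using this
    · have : (s j : ℂ) ≠ 0 := by exact_mod_cast h0
      simp only [hw, smul_smul]
      rw [mul_inv_cancel₀ this, one_smul]
  · intro j
    by_cases h0 : s j = 0
    · simp [hw0 j h0]
    · exact (hworth.1 ⟨j, h0⟩).le
  · intro x
    refine le_trans (le_of_eq ?_) (hworth.sum_inner_products_le x (s := Finset.univ))
    rw [← Finset.sum_subtype (Finset.univ.filter fun j => s j ≠ 0) (by simp)
      (fun j => ‖inner ℂ (w j) x‖ ^ 2), Finset.sum_filter]
    refine Finset.sum_congr rfl fun j _ => ?_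
    by_cases h0 : s j = 0
    · simp [h0, hw0 j h0]
    · simp [h0]
  · exact (Finset.sum_range fun i => T.singularValues i).symm

/-- A positive operator has an orthonormal basis of eigenvectors for its singular values. -/
theorem LinearMap.IsPositive.exists_orthonormalBasis_apply {n : ℕ}
    (hn : Module.finrank ℂ E = n) {T : E →ₗ[ℂ] E} (hT : T.IsPositive) :
    ∃ b : OrthonormalBasis (Fin n) ℂ E, ∀ j : Fin n, T (b j) = (T.singularValues j : ℂ) • b j := by
  obtain ⟨b, hb⟩ := T.exists_orthonormalBasis_adjoint_apply_apply hn
  refine ⟨b, fun j => ?_⟩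
  have hbj := hb j
  rw [hT.adjoint_eq] at hbj
  rcases (T.singularValues_nonneg j).eq_or_lt with h0 | h0
  · rw [← h0] at hbj ⊢
    have : inner ℂ (T (b j)) (T (b j)) = 0 := by
      rw [← hT.isSymmetric, hbj]; simp
    simpa using this
  -- From `T² b = σ² b`, the vector `(T - σ) b` is killed by `T + σ`, which is injective for `T ≥ 0`
  -- and `σ > 0`.
  · set y := T (b j) - (T.singularValues j : ℂ) • b j with hy
    have hTy : T y = -(T.singularValues j : ℂ) • y := by
      rw [hy, map_sub, map_smul, hbj, smul_sub, smul_smul]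
      module
    have h1 := hT.re_inner_nonneg_right y
    rw [hTy, inner_smul_right, inner_self_eq_norm_sq_to_K] at h1
    have h2 : 0 ≤ -(T.singularValues j * ‖y‖ ^ 2) := by
      convert h1 using 1
      simp [← Complex.ofReal_pow]
    have h3 : ‖y‖ = 0 := by
      by_contra h
      have : 0 < ‖y‖ ^ 2 := by positivity
      nlinarith
    exact sub_eq_zero.1 (norm_eq_zero.1 h3)

theorem LinearMap.singularValues_le_one {T : E →ₗ[ℂ] E} (hT : ∀ x, ‖T x‖ ≤ ‖x‖) (i : ℕ) :
    T.singularValues i ≤ 1 := by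
  rcases lt_or_ge i (Module.finrank ℂ E) with hi | hi
  · obtain ⟨b, hb⟩ := T.exists_orthonormalBasis_adjoint_apply_apply rfl
    have h1 : ‖T (b ⟨i, hi⟩)‖ ^ 2 = T.singularValues i ^ 2 := by
      have : (inner ℂ (T (b ⟨i, hi⟩)) (T (b ⟨i, hi⟩))) = (T.singularValues i : ℂ) ^ 2 := by
        rw [← LinearMap.adjoint_inner_right, hb, inner_smul_right, b.inner_eq_one, mul_one]
      rw [inner_self_eq_norm_sq_to_K] at this
      apply Complex.ofReal_injective
      simpa using this
    have h2 := hT (b ⟨i, hi⟩)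
    rw [b.orthonormal.1] at h2
    nlinarith [norm_nonneg (T (b ⟨i, hi⟩)), T.singularValues_nonneg i]
  · rw [T.singularValues_of_finrank_le hi]; exact zero_le_one

end Operators

/-! ### Ky Fan norms of matrices and norming functionals -/

section Matrices

variable {n k : ℕ}

/-- The matrix `x x*`; for a unit vector, the orthogonal projection to its span. -/
abbrev vecProj (x : EuclideanSpace ℂ (Fin n)) : Matrix (Fin n) (Fin n) ℂ :=
  Matrix.vecMulVec x.ofLp (star x.ofLp)

theorem toEuclideanLin_vecProj_apply (x y : EuclideanSpace ℂ (Fin n)) :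
    Matrix.toEuclideanLin (vecProj x) y = inner ℂ x y • x := by
  ext i
  simp only [Matrix.toLpLin_apply, PiLp.smul_apply, EuclideanSpace.inner_eq_star_dotProduct,
    smul_eq_mul, Matrix.vecMulVec_mulVec, dotProduct_comm (star x.ofLp)]
  simp [mul_comm]

theorem trace_conjTranspose_mul_eq_sum_inner (G Y : Matrix (Fin n) (Fin n) ℂ)
    {ι : Type*} [Fintype ι] (b : OrthonormalBasis ι ℂ (EuclideanSpace ℂ (Fin n))) :
    (Gᴴ * Y).trace =
      ∑ i, inner ℂ (Matrix.toEuclideanLin G (b i)) (Matrix.toEuclideanLin Y (b i)) := by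
  have h1 : (Gᴴ * Y).trace = LinearMap.trace ℂ _ (Matrix.toEuclideanLin (Gᴴ * Y)) := by
    rw [LinearMap.trace_eq_sum_inner _ (EuclideanSpace.basisFun (Fin n) ℂ)]
    simp [Matrix.trace, EuclideanSpace.inner_eq_star_dotProduct, Matrix.toLpLin_apply]
    rfl
  rw [h1, LinearMap.trace_eq_sum_inner _ b]
  refine Finset.sum_congr rfl fun i _ => ?_
  rw [← LinearMap.adjoint_inner_right, ← Matrix.toEuclideanLin_conjTranspose_eq_adjoint]
  simp [Matrix.toLpLin_apply, Matrix.mulVec_mulVec]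

theorem trace_conjTranspose_mul_vecProj (G : Matrix (Fin n) (Fin n) ℂ)
    (x : EuclideanSpace ℂ (Fin n)) :
    (Gᴴ * vecProj x).trace = inner ℂ (Matrix.toEuclideanLin G x) x := by
  rw [trace_conjTranspose_mul_eq_sum_inner _ _ (EuclideanSpace.basisFun (Fin n) ℂ)]
  conv_rhs => rw [← (EuclideanSpace.basisFun (Fin n) ℂ).sum_repr' x]
  simp only [toEuclideanLin_vecProj_apply, map_sum, map_smul, sum_inner, inner_smul_left,
    inner_smul_right, inner_conj_symm]
  simp only [(EuclideanSpace.basisFun (Fin n) ℂ).sum_repr' x]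

theorem trace_conjTranspose_vecProj_mul (Y : Matrix (Fin n) (Fin n) ℂ)
    (x : EuclideanSpace ℂ (Fin n)) :
    ((vecProj x)ᴴ * Y).trace = inner ℂ x (Matrix.toEuclideanLin Y x) := by
  rw [← inner_conj_symm, ← trace_conjTranspose_mul_vecProj, starRingEnd_apply,
    ← Matrix.trace_conjTranspose, Matrix.conjTranspose_mul, Matrix.conjTranspose_conjTranspose]

theorem sum_re_inner_le_kyFanNorm (hk : 1 ≤ k) (hkn : k ≤ n) (Y : Matrix (Fin n) (Fin n) ℂ)
    {u : Fin k → EuclideanSpace ℂ (Fin n)} (hu : Orthonormal ℂ u) :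
    ∑ i, (inner ℂ (u i) (Matrix.toEuclideanLin Y (u i))).re ≤ kyFanNorm k Y :=
  LinearMap.sum_re_inner_le_sum_singularValues finrank_euclideanSpace_fin hk hkn _ hu

theorem orderedEigenvalue_antitone {A : Matrix (Fin n) (Fin n) ℂ} (hA : A.IsHermitian) :
    Antitone (orderedEigenvalue hA) := fun _ _ hij =>
  hA.eigenvalues₀_antitone hij

theorem exists_orthonormalBasis_orderedEigenvalue {A : Matrix (Fin n) (Fin n) ℂ}
    (hA : A.IsHermitian) : ∃ b : OrthonormalBasis (Fin n) ℂ (EuclideanSpace ℂ (Fin n)),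
      ∀ j, Matrix.toEuclideanLin A (b j) = (orderedEigenvalue hA j : ℂ) • b j := by
  have hT := Matrix.isSymmetric_toEuclideanLin_iff.mpr hA
  refine ⟨(hT.eigenvectorBasis finrank_euclideanSpace).reindex
    (finCongr (Fintype.card_fin n)), fun j => ?_⟩
  rw [OrthonormalBasis.reindex_apply]
  exact hT.apply_eigenvectorBasis finrank_euclideanSpace _

theorem orderedEigenvalue_nonneg {A : Matrix (Fin n) (Fin n) ℂ} (hA : A.PosSemidef) (j : Fin n) :
    0 ≤ orderedEigenvalue hA.isHermitian j :=
  (Matrix.isPositive_toEuclideanLin_iff.mpr hA).nonneg_eigenvalues finrank_euclideanSpace _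

/-- The Ky Fan norm of a positive semidefinite matrix is attained on an orthonormal family. -/
theorem exists_orthonormal_kyFanNorm_eq (hkn : k ≤ n) {A : Matrix (Fin n) (Fin n) ℂ}
    (hA : A.PosSemidef) : ∃ v : Fin k → EuclideanSpace ℂ (Fin n), Orthonormal ℂ v ∧
      kyFanNorm k A = ∑ i, (inner ℂ (v i) (Matrix.toEuclideanLin A (v i))).re := by
  obtain ⟨v, hv⟩ := (Matrix.isPositive_toEuclideanLin_iff.mpr hA).exists_orthonormalBasis_apply
    finrank_euclideanSpace_fin
  refine ⟨fun i => v (Fin.castLE hkn i), v.orthonormal.comp _ (Fin.castLE_injective hkn), ?_⟩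
  rw [kyFanNorm, Finset.sum_range]
  refine Finset.sum_congr rfl fun i _ => ?_
  rw [hv, inner_smul_right, v.inner_eq_one]
  simp

/-- Ky Fan's inequality is applied twice: the eigenvalue version to singular vectors, the singular
value version to eigenvectors. The two lists need not be matched term by term. -/
theorem kyFanNorm_eq_sum_orderedEigenvalue (hk : 1 ≤ k) (hkn : k ≤ n)
    {A : Matrix (Fin n) (Fin n) ℂ} (hA : A.PosSemidef) :
    kyFanNorm k A = ∑ i : Fin k, orderedEigenvalue hA.isHermitian (Fin.castLE hkn i) := by
  obtain ⟨e, he⟩ := exists_orthonormalBasis_orderedEigenvalue hA.isHermitian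
  apply le_antisymm
  · obtain ⟨v, hv, h⟩ := exists_orthonormal_kyFanNorm_eq hkn hA
    rw [h]
    exact LinearMap.sum_re_inner_le_sum_castLE hk hkn _ e e (orderedEigenvalue_antitone _)
      (orderedEigenvalue_nonneg hA) he (fun j => (e.orthonormal.1 j).le)
      (fun x => (e.sum_sq_norm_inner_right x).le) hv
  · refine le_of_eq_of_le ?_ (sum_re_inner_le_kyFanNorm hk hkn A
      (e.orthonormal.comp _ (Fin.castLE_injective hkn)))
    refine Finset.sum_congr rfl fun i _ => ?_
    simp only [Function.comp_apply]
    rw [he, inner_smul_right, e.inner_eq_one]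
    simp

theorem kyFanNorm_le_of_contraction {Y : Matrix (Fin n) (Fin n) ℂ}
    (hY : ∀ x, ‖Matrix.toEuclideanLin Y x‖ ≤ ‖x‖) : kyFanNorm k Y ≤ k := by
  calc kyFanNorm k Y ≤ ∑ _i ∈ Finset.range k, (1 : ℝ) :=
        Finset.sum_le_sum fun i _ => LinearMap.singularValues_le_one hY i
    _ = k := by simp

theorem kyFanNorm_vecProj_le (hkn : k ≤ n) (x : EuclideanSpace ℂ (Fin n)) :
    kyFanNorm k (vecProj x) ≤ ‖x‖ ^ 2 := by
  obtain ⟨v, hv, h⟩ := exists_orthonormal_kyFanNorm_eq hkn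
    (Matrix.posSemidef_vecMulVec_self_star x.ofLp)
  rw [h]
  refine le_of_eq_of_le (Finset.sum_congr rfl fun i _ => ?_)
    (hv.sum_inner_products_le x (s := Finset.univ))
  rw [toEuclideanLin_vecProj_apply, inner_smul_right, ← inner_conj_symm,
    ← Complex.normSq_eq_conj_mul_self, Complex.ofReal_re, Complex.normSq_eq_norm_sq]

theorem convex_matrixSubdifferential (f : Matrix (Fin n) (Fin n) ℂ → ℝ)
    (A : Matrix (Fin n) (Fin n) ℂ) : Convex ℝ (matrixSubdifferential f A) := by
  intro G hG H hH a b ha hb hab Y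
  have h1 : (Gᴴ * (Y - A)).trace.re ≤ f Y - f A := hG Y
  have h2 : (Hᴴ * (Y - A)).trace.re ≤ f Y - f A := hH Y
  change ((a • G + b • H)ᴴ * (Y - A)).trace.re ≤ f Y - f A
  rw [Matrix.conjTranspose_add, Matrix.conjTranspose_smul, Matrix.conjTranspose_smul,
    Matrix.add_mul, Matrix.smul_mul, Matrix.smul_mul, Matrix.trace_add, Matrix.trace_smul,
    Matrix.trace_smul, Complex.add_re, Complex.smul_re, Complex.smul_re, star_trivial, star_trivial,
    smul_eq_mul, smul_eq_mul]
  calc _ ≤ a * (f Y - f A) + b * (f Y - f A) := by gcongr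
    _ = f Y - f A := by rw [← add_mul, hab, one_mul]

theorem sum_vecProj_mem_matrixSubdifferential (hk : 1 ≤ k) (hkn : k ≤ n)
    {A : Matrix (Fin n) (Fin n) ℂ} (hA : A.PosSemidef) {u : Fin k → EuclideanSpace ℂ (Fin n)}
    (hu : Orthonormal ℂ u) (huA : ∀ i : Fin k, Matrix.toEuclideanLin A (u i) =
      (orderedEigenvalue hA.isHermitian (Fin.castLE hkn i) : ℂ) • u i) :
    ∑ i, vecProj (u i) ∈ matrixSubdifferential (kyFanNorm k) A := by
  intro Y
  change ((∑ i, vecProj (u i))ᴴ * (Y - A)).trace.re ≤ _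
  have h : ∀ Z, ((∑ i, vecProj (u i))ᴴ * Z).trace.re =
      ∑ i, (inner ℂ (u i) (Matrix.toEuclideanLin Z (u i))).re := fun Z => by
    rw [Matrix.conjTranspose_sum, Finset.sum_mul, Matrix.trace_sum, Complex.re_sum]
    exact Finset.sum_congr rfl fun i _ => by rw [trace_conjTranspose_vecProj_mul]
  have h1 : ((∑ i, vecProj (u i))ᴴ * A).trace.re = kyFanNorm k A := by
    rw [h, kyFanNorm_eq_sum_orderedEigenvalue hk hkn hA]
    refine Finset.sum_congr rfl fun i _ => ?_
    rw [huA, inner_smul_right, inner_self_eq_norm_sq_to_K, hu.1 i]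
    simp
  rw [Matrix.mul_sub, Matrix.trace_sub, Complex.sub_re, h1, h]
  linarith [sum_re_inner_le_kyFanNorm hk hkn Y hu]

/-- A subgradient of the Ky Fan norm at a positive semidefinite matrix is a norming functional. -/
theorem norming_of_mem_matrixSubdifferential (hk : 1 ≤ k) (hkn : k ≤ n)
    {A G : Matrix (Fin n) (Fin n) ℂ} (hA : A.PosSemidef)
    (hG : G ∈ matrixSubdifferential (kyFanNorm k) A) :
    (Gᴴ * A).trace.re = kyFanNorm k A ∧ ∀ Y, (Gᴴ * Y).trace.re ≤ kyFanNorm k Y := by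
  have h : ∀ Y, (Gᴴ * Y).trace.re - (Gᴴ * A).trace.re ≤ kyFanNorm k Y - kyFanNorm k A := by
    intro Y
    have : (Gᴴ * (Y - A)).trace.re ≤ kyFanNorm k Y - kyFanNorm k A := hG Y
    rwa [Matrix.mul_sub, Matrix.trace_sub, Complex.sub_re] at this
  -- Of homogeneity, only this bound and the value at `0` are needed.
  have h2 : kyFanNorm k ((2 : ℝ) • A) ≤ 2 * kyFanNorm k A := by
    obtain ⟨v, hv, hvA⟩ := exists_orthonormal_kyFanNorm_eq hkn
      (hA.smul (zero_le_two (α := ℝ)))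
    have h3 := sum_re_inner_le_kyFanNorm hk hkn A hv
    rw [hvA]
    refine le_of_eq_of_le ?_ (mul_le_mul_of_nonneg_left h3 zero_le_two)
    rw [Finset.mul_sum]
    refine Finset.sum_congr rfl fun i _ => ?_
    have : (2 : ℝ) • A = (2 : ℂ) • A := by ext; simp
    rw [this, map_smul, LinearMap.smul_apply, inner_smul_right]
    simp
  have h0 : kyFanNorm k (0 : Matrix (Fin n) (Fin n) ℂ) = 0 := by simp [kyFanNorm]
  have hA1 : (Gᴴ * A).trace.re = kyFanNorm k A := by
    have h3 := h 0
    have h4 := h ((2 : ℝ) • A)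
    rw [Matrix.mul_smul, Matrix.trace_smul, Complex.smul_re, smul_eq_mul] at h4
    rw [h0] at h3
    simp only [Matrix.mul_zero, Matrix.trace_zero, Complex.zero_re] at h3
    linarith
  exact ⟨hA1, fun Y => by linarith [h Y]⟩

end Matrices

/-! ### Structure of norming matrices -/

section Norming

variable {n k : ℕ} {G : Matrix (Fin n) (Fin n) ℂ}

/-- The condition on `c` says `|1 - c| = 1`. -/
theorem norm_toEuclideanLin_one_sub_smul_vecProj {c : ℂ} (hc : ‖c‖ ^ 2 = 2 * c.re)
    {x : EuclideanSpace ℂ (Fin n)} (hx : ‖x‖ = 1) (y : EuclideanSpace ℂ (Fin n)) :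
    ‖Matrix.toEuclideanLin (1 - c • vecProj x) y‖ = ‖y‖ := by
  have h1 : Matrix.toEuclideanLin (1 - c • vecProj x) y = y - (c * inner ℂ x y) • x := by
    rw [map_sub, map_smul, LinearMap.sub_apply, LinearMap.smul_apply, toEuclideanLin_vecProj_apply,
      smul_smul]
    simp
  have h2 : ‖y - (c * inner ℂ x y) • x‖ ^ 2 = ‖y‖ ^ 2 := by
    rw [@norm_sub_sq ℂ, norm_smul, norm_mul, hx, inner_smul_right, mul_assoc,
      ← inner_conj_symm y x, Complex.mul_conj, mul_one, mul_pow, hc, Complex.normSq_eq_norm_sq]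
    rw [RCLike.re_to_complex, mul_comm c, Complex.re_ofReal_mul]
    ring
  rw [h1]
  exact (pow_left_inj₀ (norm_nonneg _) (norm_nonneg _) two_ne_zero).1 h2

theorem re_inner_le_one_of_norming (hkn : k ≤ n)
    (hG : ∀ Y, (Gᴴ * Y).trace.re ≤ kyFanNorm k Y) (x : EuclideanSpace ℂ (Fin n)) :
    (inner ℂ (Matrix.toEuclideanLin G x) x).re ≤ ‖x‖ ^ 2 := by
  rw [← trace_conjTranspose_mul_vecProj]
  exact (hG _).trans (kyFanNorm_vecProj_le hkn x)

/-- `G` is tested on the isometry that is diagonal in `e` with the signs of the diagonal entries of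
`G`. -/
theorem sum_abs_re_inner_le_of_norming (hG : ∀ Y, (Gᴴ * Y).trace.re ≤ kyFanNorm k Y)
    (e : OrthonormalBasis (Fin n) ℂ (EuclideanSpace ℂ (Fin n))) :
    ∑ j, |(inner ℂ (Matrix.toEuclideanLin G (e j)) (e j)).re| ≤ k := by
  set d : Fin n → ℝ := fun j => (inner ℂ (Matrix.toEuclideanLin G (e j)) (e j)).re with hd
  set ε : Fin n → ℝ := fun j => if 0 ≤ d j then 1 else -1 with hε
  have habs : ∀ j, |d j| = ε j * d j := by
    intro j
    by_cases h : 0 ≤ d j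
    · simp [hε, h, abs_of_nonneg]
    · simp [hε, h, abs_of_neg (not_le.1 h)]
  set Y := ∑ j, (ε j : ℂ) • vecProj (e j) with hY
  have hYx : ∀ x, Matrix.toEuclideanLin Y x = ∑ j, ((ε j : ℂ) * inner ℂ (e j) x) • e j := by
    intro x
    simp only [hY, map_sum, map_smul, LinearMap.sum_apply, LinearMap.smul_apply,
      toEuclideanLin_vecProj_apply, smul_smul]
  have hcontr : ∀ x, ‖Matrix.toEuclideanLin Y x‖ ≤ ‖x‖ := by
    intro x
    have h1 : ‖Matrix.toEuclideanLin Y x‖ ^ 2 = ‖x‖ ^ 2 := by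
      rw [← e.sum_sq_norm_inner_right, ← e.sum_sq_norm_inner_right x]
      refine Finset.sum_congr rfl fun j _ => ?_
      rw [hYx, e.orthonormal.inner_right_fintype, norm_mul]
      have : ‖(ε j : ℂ)‖ = 1 := by
        by_cases h : 0 ≤ d j <;> simp [hε, h]
      rw [this, one_mul]
    exact ((pow_left_inj₀ (norm_nonneg _) (norm_nonneg _) two_ne_zero).1 h1).le
  refine le_of_eq_of_le ?_ ((hG Y).trans (kyFanNorm_le_of_contraction hcontr))
  rw [hY, Matrix.mul_sum, Matrix.trace_sum, Complex.re_sum]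
  refine Finset.sum_congr rfl fun j _ => ?_
  rw [Matrix.mul_smul, Matrix.trace_smul, trace_conjTranspose_mul_vecProj, smul_eq_mul,
    Complex.re_ofReal_mul, ← habs]

/-- A matrix of trace `k` in the unit ball of the dual of the Ky Fan norm is positive. -/
theorem isPositive_of_norming (hG : ∀ Y, (Gᴴ * Y).trace.re ≤ kyFanNorm k Y)
    (htr : Gᴴ.trace.re = k) : (Matrix.toEuclideanLin G).IsPositive := by
  have hunit : ∀ x : EuclideanSpace ℂ (Fin n), ‖x‖ = 1 →
      0 ≤ (inner ℂ (Matrix.toEuclideanLin G x) x).re ∧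
      (inner ℂ (Matrix.toEuclideanLin G x) x).im = 0 := by
    intro x hx
    set z := inner ℂ (Matrix.toEuclideanLin G x) x with hz
    -- Testing on the isometry `1 - c x x*` gives `k - Re (c z) ≤ k`.
    have key : ∀ c : ℂ, ‖c‖ ^ 2 = 2 * c.re → 0 ≤ (c * z).re := by
      intro c hc
      have h := (hG (1 - c • vecProj x)).trans (kyFanNorm_le_of_contraction
        fun y => (norm_toEuclideanLin_one_sub_smul_vecProj hc hx y).le)
      rw [Matrix.mul_sub, Matrix.mul_one, Matrix.trace_sub, Complex.sub_re, htr, Matrix.mul_smul,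
        Matrix.trace_smul, trace_conjTranspose_mul_vecProj, smul_eq_mul, ← hz] at h
      linarith
    have hre : 0 ≤ z.re := by
      have := key 2 (by norm_num)
      simpa using this
    refine ⟨hre, ?_⟩
    have hquad : ∀ t : ℝ, 0 ≤ t ^ 2 * z.re - t * z.im := by
      intro t
      have ht : 0 < 1 + t ^ 2 := by positivity
      -- Rational parametrization of the circle `|1 - c| = 1`. It is tangent to the imaginary axis
      -- at `0`, so small `t` of either sign rules out a nonzero `z.im`.
      have := key ⟨2 * t ^ 2 / (1 + t ^ 2), 2 * t / (1 + t ^ 2)⟩ (by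
        rw [← Complex.normSq_eq_norm_sq, Complex.normSq_mk]
        field_simp
        ring)
      rw [Complex.mul_re] at this
      have h2 : 2 * t ^ 2 / (1 + t ^ 2) * z.re - 2 * t / (1 + t ^ 2) * z.im =
          2 * (t ^ 2 * z.re - t * z.im) / (1 + t ^ 2) := by ring
      simp only [h2] at this
      rw [le_div_iff₀ ht] at this
      linarith
    have h := hquad (z.im / (z.re + 1))
    have h2 : (z.im / (z.re + 1)) ^ 2 * z.re - z.im / (z.re + 1) * z.im =
        -z.im ^ 2 / (z.re + 1) ^ 2 := by
      field_simp
      ring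
    rw [h2, le_div_iff₀ (by positivity)] at h
    nlinarith
  rw [LinearMap.isPositive_iff_complex]
  intro x
  have hscale : ∃ y : EuclideanSpace ℂ (Fin n), ∃ r : ℝ, x = (r : ℂ) • y ∧ (‖y‖ = 1 ∨ r = 0) := by
    by_cases h0 : x = 0
    · exact ⟨0, 0, by simp [h0], Or.inr rfl⟩
    · have : ‖x‖ ≠ 0 := norm_ne_zero_iff.2 h0
      refine ⟨((‖x‖⁻¹ : ℝ) : ℂ) • x, ‖x‖, ?_, Or.inl ?_⟩
      · rw [smul_smul, ← Complex.ofReal_mul, mul_inv_cancel₀ this, Complex.ofReal_one, one_smul]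
      · rw [norm_smul, Complex.norm_real, norm_inv, norm_norm, inv_mul_cancel₀ this]
  obtain ⟨y, r, rfl, hy | rfl⟩ := hscale
  · obtain ⟨h1, h2⟩ := hunit y hy
    have h3 : inner ℂ (Matrix.toEuclideanLin G ((r : ℂ) • y)) ((r : ℂ) • y) =
        ((r ^ 2 : ℝ) : ℂ) * inner ℂ (Matrix.toEuclideanLin G y) y := by
      rw [map_smul, inner_smul_left, inner_smul_right, Complex.conj_ofReal]
      push_cast
      ring
    rw [h3, RCLike.re_to_complex]
    constructor
    · apply Complex.ext
      · simp
      · simp [h2, -Complex.ofReal_pow]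
    · rw [Complex.re_ofReal_mul]
      positivity
  · simp

/-- Decomposition of a subgradient: the spectral projection of `A` for the eigenvalues above the
`k`-th one, plus a combination of projections to orthonormal eigenvectors for that eigenvalue. -/
theorem exists_decomposition_of_norming (hk : 1 ≤ k) (hkn : k ≤ n) {m : Fin n}
    (hm : (m : ℕ) + 1 = k)
    {A : Matrix (Fin n) (Fin n) ℂ} (hA : A.PosSemidef)
    (hpos : 0 < orderedEigenvalue hA.isHermitian m)
    (e : OrthonormalBasis (Fin n) ℂ (EuclideanSpace ℂ (Fin n)))
    (he : ∀ j, Matrix.toEuclideanLin A (e j) = (orderedEigenvalue hA.isHermitian j : ℂ) • e j)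
    (hGA : (Gᴴ * A).trace.re = kyFanNorm k A) (hG : ∀ Y, (Gᴴ * Y).trace.re ≤ kyFanNorm k Y) :
    ∃ (f : OrthonormalBasis (Fin n) ℂ (EuclideanSpace ℂ (Fin n))) (η : Fin n → ℝ),
      (∀ j, 0 ≤ η j) ∧ (∀ j, η j ≤ 1) ∧
      (∀ j, η j ≠ 0 → Matrix.toEuclideanLin A (f j) =
        (orderedEigenvalue hA.isHermitian m : ℂ) • f j) ∧
      ∑ j, η j + (Finset.univ.filter fun j => orderedEigenvalue hA.isHermitian m <
        orderedEigenvalue hA.isHermitian j).card = k ∧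
      G = (∑ j with orderedEigenvalue hA.isHermitian m <
        orderedEigenvalue hA.isHermitian j, vecProj (e j)) + ∑ j, η j • vecProj (f j) := by
  set s := orderedEigenvalue hA.isHermitian with hs
  set t := s m with ht
  set T := Matrix.toEuclideanLin G with hT
  have hd : ∑ j, s j * (inner ℂ (T (e j)) (e j)).re = ∑ i : Fin k, s (Fin.castLE hkn i) := by
    rw [hs, ← kyFanNorm_eq_sum_orderedEigenvalue hk hkn hA, ← hGA,
      trace_conjTranspose_mul_eq_sum_inner G A e, Complex.re_sum]
    refine Finset.sum_congr rfl fun j _ => ?_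
    rw [he, inner_smul_right, Complex.re_ofReal_mul]
  have hd1 : ∀ j, (inner ℂ (T (e j)) (e j)).re ≤ 1 := fun j => by
    have := re_inner_le_one_of_norming hkn hG (e j)
    rwa [e.orthonormal.1 j, one_pow] at this
  obtain ⟨hgt, hlt, hsum⟩ := eq_of_sum_mul_eq_sum_castLE hkn hm
    (orderedEigenvalue_antitone hA.isHermitian) (orderedEigenvalue_nonneg hA) hpos hd1
    (sum_abs_re_inner_le_of_norming hG e) hd
  have htr : Gᴴ.trace.re = k := by
    have := trace_conjTranspose_mul_eq_sum_inner G 1 e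
    rw [Matrix.mul_one] at this
    rw [this, ← hsum, Complex.re_sum]
    simp [Matrix.toLpLin_apply, hT]
  have hTpos : T.IsPositive := isPositive_of_norming hG htr
  have hTpos' : (1 - T).IsPositive := by
    refine ⟨LinearMap.IsSymmetric.sub LinearMap.IsSymmetric.id hTpos.isSymmetric, fun x => ?_⟩
    have := re_inner_le_one_of_norming hkn hG x
    rw [LinearMap.sub_apply, inner_sub_left, map_sub, Module.End.one_apply,
      inner_self_eq_norm_sq, RCLike.re_to_complex]
    linarith
  have hTgt : ∀ j, t < s j → T (e j) = e j := by
    intro j hj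
    have := hTpos'.apply_eq_zero_of_re_inner_eq_zero (x := e j) (by
      rw [LinearMap.sub_apply, inner_sub_left, Complex.sub_re, hgt j hj, Module.End.one_apply,
        e.inner_eq_one, Complex.one_re, sub_self])
    rw [LinearMap.sub_apply, Module.End.one_apply] at this
    exact (sub_eq_zero.1 this).symm
  have hTlt : ∀ j, s j < t → T (e j) = 0 := fun j hj =>
    hTpos.apply_eq_zero_of_re_inner_eq_zero (hlt j hj)
  set P := Finset.univ.filter (fun j => t < s j) with hP
  set C := ∑ j ∈ P, vecProj (e j) with hC
  have hCx : ∀ x, Matrix.toEuclideanLin C x = ∑ j ∈ P, inner ℂ (e j) x • e j := fun x => by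
    simp only [hC, map_sum, LinearMap.sum_apply, toEuclideanLin_vecProj_apply]
  have hCe : ∀ j, Matrix.toEuclideanLin C (e j) = if t < s j then e j else 0 := fun j => by
    rw [hCx]
    simp [e.inner_eq_ite, hP]
  have hCherm : C.IsHermitian :=
    (Matrix.posSemidef_sum P fun j _ => Matrix.posSemidef_vecMulVec_self_star _).isHermitian
  have hGherm : G.IsHermitian := Matrix.isSymmetric_toEuclideanLin_iff.1 hTpos.isSymmetric
  have hH : (G - C).IsHermitian := hGherm.sub hCherm
  have hHsymm := Matrix.isSymmetric_toEuclideanLin_iff.2 hH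
  obtain ⟨f, hf⟩ := exists_orthonormalBasis_orderedEigenvalue hH
  set η := orderedEigenvalue hH with hη
  have hHe : ∀ j, s j ≠ t → Matrix.toEuclideanLin (G - C) (e j) = 0 := by
    intro j hj
    rw [map_sub, LinearMap.sub_apply, hCe]
    rcases hj.lt_or_gt with h | h
    · rw [if_neg (not_lt.2 h.le), sub_zero]
      exact hTlt j h
    · rw [if_pos h, sub_eq_zero]
      exact hTgt j h
  -- Eigenvectors of `G - C` with nonzero eigenvalue are orthogonal to its kernel, hence lie in the
  -- `t`-eigenspace of `A`.
  have horth : ∀ j, η j ≠ 0 → ∀ i, s i ≠ t → inner ℂ (e i) (f j) = 0 := by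
    intro j hj i hi
    have h1 := hHsymm (e i) (f j)
    rw [hHe i hi, hf, inner_zero_left, inner_smul_right] at h1
    have h2 : (η j : ℂ) ≠ 0 := by exact_mod_cast hj
    exact (mul_eq_zero.1 h1.symm).resolve_left h2
  have hηeq : ∀ j, η j ≠ 0 → η j = (inner ℂ (T (f j)) (f j)).re := by
    intro j hj
    have h1 : Matrix.toEuclideanLin C (f j) = 0 := by
      rw [hCx]
      refine Finset.sum_eq_zero fun i hi => ?_
      rw [horth j hj i (Finset.mem_filter.1 hi).2.ne', zero_smul]
    have h2 : T (f j) = (η j : ℂ) • f j := by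
      rw [← hf, map_sub, LinearMap.sub_apply, h1, sub_zero]
    rw [h2, inner_smul_left, f.inner_eq_one]
    simp
  have hGdec : G = C + ∑ j, η j • vecProj (f j) := by
    rw [← sub_eq_iff_eq_add']
    apply Matrix.toEuclideanLin.injective
    refine f.toBasis.ext fun j => ?_
    have hη' : ∀ i, η i • vecProj (f i) = (η i : ℂ) • vecProj (f i) := fun i => by ext; simp
    simp only [OrthonormalBasis.coe_toBasis, hf, hη', map_sum, map_smul, LinearMap.sum_apply,
      LinearMap.smul_apply, toEuclideanLin_vecProj_apply, f.inner_eq_ite]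
    simp
  refine ⟨f, η, fun j => ?_, fun j => ?_, fun j hj => ?_, ?_, hGdec⟩
  · by_cases hj : η j = 0
    · exact hj.ge
    · rw [hηeq j hj]
      exact hTpos.re_inner_nonneg_left _
  · by_cases hj : η j = 0
    · exact hj.le.trans zero_le_one
    · rw [hηeq j hj]
      have := re_inner_le_one_of_norming hkn hG (f j)
      rwa [f.orthonormal.1 j, one_pow] at this
  · conv_lhs => rw [← e.sum_repr' (f j)]
    conv_rhs => rw [← e.sum_repr' (f j)]
    rw [map_sum, Finset.smul_sum]
    refine Finset.sum_congr rfl fun i _ => ?_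
    by_cases hi : s i = t
    · rw [map_smul, he, smul_comm, hi]
    · simp [horth j hj i hi]
  · have htrP : ∀ x : EuclideanSpace ℂ (Fin n), ‖x‖ = 1 → (vecProj x).trace = 1 := fun x hx => by
      have := trace_conjTranspose_mul_vecProj 1 x
      rw [Matrix.conjTranspose_one, Matrix.one_mul] at this
      rw [this]
      simp [hx]
    have h1 : G.trace.re = k := by rw [← htr, hGherm.eq]
    rw [hGdec, Matrix.trace_add, hC, Matrix.trace_sum, Matrix.trace_sum, Complex.add_re,
      Complex.re_sum, Complex.re_sum] at h1
    simp only [Matrix.trace_smul, htrP _ (e.orthonormal.1 _), htrP _ (f.orthonormal.1 _)] at h1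
    rw [← h1]
    simp [add_comm]

end Norming

/-! ### The subdifferential formula -/

theorem mainTheorem7 {n k : ℕ} (hk : 1 ≤ k) (hkn : k ≤ n)
    (A : Matrix (Fin n) (Fin n) ℂ) (hA : A.PosSemidef)
    (hpos : 0 < orderedEigenvalue hA.isHermitian ⟨k - 1, by omega⟩) :
    matrixSubdifferential (kyFanNorm k) A =
      convexHull ℝ
        {G : Matrix (Fin n) (Fin n) ℂ | ∃ u : Fin k → EuclideanSpace ℂ (Fin n),
          Orthonormal ℂ u ∧
          (∀ i : Fin k, Matrix.toEuclideanLin A (u i) =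
            (orderedEigenvalue hA.isHermitian (Fin.castLE hkn i) : ℂ) • u i) ∧
          G = ∑ i : Fin k, Matrix.vecMulVec (u i).ofLp (star (u i).ofLp)} := by
  apply Set.Subset.antisymm
  · intro G hGsub
    obtain ⟨hGA, hG⟩ := norming_of_mem_matrixSubdifferential hk hkn hA hGsub
    obtain ⟨e, he⟩ := exists_orthonormalBasis_orderedEigenvalue hA.isHermitian
    obtain ⟨f, η, hη0, hη1, hf, hcard, rfl⟩ :=
      exists_decomposition_of_norming hk hkn (Nat.sub_add_cancel hk) hA hpos e he hGA hG
    have hanti := orderedEigenvalue_antitone hA.isHermitian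
    set s := orderedEigenvalue hA.isHermitian with hs
    set t := s ⟨k - 1, by omega⟩ with ht
    have hlt : ∀ j : Fin n, t < s j → (j : ℕ) < k := fun j hj => by
      by_contra h
      exact hj.not_ge (hanti (Fin.mk_le_mk.2 (by omega) : (⟨k - 1, by omega⟩ : Fin n) ≤ j))
    have hge : ∀ i : Fin k, t ≤ s (Fin.castLE hkn i) := fun i =>
      hanti (Fin.mk_le_mk.2 (by have := i.2; omega) : Fin.castLE hkn i ≤ ⟨k - 1, by omega⟩)
    have hsumP : ∀ {M : Type} [AddCommMonoid M] (F : Fin n → M),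
        ∑ j with t < s j, F j =
          ∑ i : {i : Fin k // t < s (Fin.castLE hkn i)}, F (Fin.castLE hkn i) := by
      intro M _ F
      rw [← Finset.sum_subtype (Finset.univ.filter fun i : Fin k => t < s (Fin.castLE hkn i))
        (by simp) (fun i => F (Fin.castLE hkn i)), Finset.sum_filter, Finset.sum_filter,
        Fin.sum_castLE_eq_sum_ite hkn fun j => if t < s j then F j else 0]
      refine Finset.sum_congr rfl fun j _ => ?_
      by_cases h : t < s j
      · simp [h, hlt j h]
      · simp [h]
    have hcardP : (Finset.univ.filter fun j => t < s j).card =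
        Fintype.card {i : Fin k // t < s (Fin.castLE hkn i)} := by
      rw [Finset.card_eq_sum_ones, hsumP, Finset.sum_const, Finset.card_univ, smul_eq_mul, mul_one]
    have hcompl := Fintype.card_subtype_compl fun i : Fin k => t < s (Fin.castLE hkn i)
    have hcardle := Fintype.card_subtype_le fun i : Fin k => t < s (Fin.castLE hkn i)
    rw [Fintype.card_fin] at hcompl hcardle
    -- Only indices with `η j ≠ 0` are admitted, since only there is `f j` known to be an
    -- eigenvector of `A`.
    refine (convex_convexHull ℝ _).add_sum_smul_mem_of_hypersimplex _ (fun j => vecProj (f j))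
      (Fintype.card {i : Fin k // ¬ t < s (Fin.castLE hkn i)}) {j | η j ≠ 0} ?_ η hη0 hη1
      (fun j hj => hj) ?_
    · intro S hS hSη
      apply subset_convexHull
      let σ : {i : Fin k // ¬ t < s (Fin.castLE hkn i)} ≃ S :=
        Fintype.equivOfCardEq (by rw [Fintype.card_coe, hS])
      -- Indices with eigenvalue above `t` keep `e`; the other indices below `k` all have eigenvalue
      -- `t` and receive the `f l`, `l ∈ S`, in any order.
      let u : Fin k → EuclideanSpace ℂ (Fin n) := fun i =>
        if h : t < s (Fin.castLE hkn i) then e (Fin.castLE hkn i) else f (σ ⟨i, h⟩)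
      have hu1 : ∀ (i : Fin k) (h : t < s (Fin.castLE hkn i)), u i = e (Fin.castLE hkn i) :=
        fun i h => dif_pos h
      have hu2 : ∀ (i : Fin k) (h : ¬ t < s (Fin.castLE hkn i)), u i = f (σ ⟨i, h⟩) :=
        fun i h => dif_neg h
      have hef : ∀ (j : Fin n) (l : S), t < s j → inner ℂ (e j) (f l) = 0 := by
        intro j l hj
        have h1 := (Matrix.isSymmetric_toEuclideanLin_iff.2 hA.isHermitian) (e j) (f l)
        rw [he, hf l (hSη l l.2), inner_smul_left, inner_smul_right, Complex.conj_ofReal] at h1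
        have h2 : ((s j : ℂ) - (t : ℂ)) * inner ℂ (e j) (f l) = 0 := by
          rw [sub_mul, h1, sub_self]
        refine (mul_eq_zero.1 h2).resolve_left ?_
        rw [← Complex.ofReal_sub]
        exact_mod_cast (sub_pos.2 hj).ne'
      refine ⟨u, ?_, fun i => ?_, ?_⟩
      · rw [orthonormal_iff_ite]
        intro i j
        by_cases hi : t < s (Fin.castLE hkn i) <;> by_cases hj : t < s (Fin.castLE hkn j)
        · rw [hu1 i hi, hu1 j hj, e.inner_eq_ite]
          simp [Fin.ext_iff]
        · have hij : i ≠ j := by rintro rfl; exact hj hi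
          rw [hu1 i hi, hu2 j hj, hef _ _ hi, if_neg hij]
        · have hij : i ≠ j := by rintro rfl; exact hi hj
          rw [hu2 i hi, hu1 j hj, ← inner_conj_symm, hef _ _ hj, map_zero, if_neg hij]
        · rw [hu2 i hi, hu2 j hj, f.inner_eq_ite]
          simp
      · by_cases hi : t < s (Fin.castLE hkn i)
        · rw [hu1 i hi, he]
        · rw [hu2 i hi, hf _ (hSη _ (σ _).2), le_antisymm (not_lt.1 hi) (hge i)]
      · rw [hsumP, ← Fintype.sum_subtype_add_sum_subtype
          (fun i : Fin k => t < s (Fin.castLE hkn i)) (fun i => vecProj (u i))]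
        congr 1
        · exact Finset.sum_congr rfl fun i _ => by rw [hu1 i i.2]
        · rw [← Finset.sum_coe_sort S, ← σ.sum_comp]
          exact Finset.sum_congr rfl fun i _ => by rw [hu2 i i.2]
    · have : (k : ℝ) = Fintype.card {i : Fin k // ¬ t < s (Fin.castLE hkn i)} +
          (Finset.univ.filter fun j => t < s j).card := by
        rw [hcardP]
        norm_cast
        omega
      linarith
  · refine convexHull_min ?_ (convex_matrixSubdifferential _ A)
    rintro G ⟨u, hu, huA, rfl⟩
    exact sum_vecProj_mem_matrixSubdifferential hk hkn hA hu huA
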